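/- Let $T$ be a finite tree with $|T|\ge 1$ vertices. A subtree of $T$ is a nonempty subgraph of $T$ that is itself a tree. Let $\mu(T)$ be the average number of vertices of a subtree of $T$, the average being taken over all subtrees of $T$, and let $D(T)=\mu(T)/|T|$ be the subtree density of $T$. A tree is called series-reduced if it has no vertex of degree $2$. (a) For every finite tree $T$ we have $\frac13\le D(T)\le 1$, and the set of values $\{D(T) : T \text{ a finite tree}\}$ is dense in the interval $[\frac13,1]$. (b) For every finite series-reduced tree $T$ with at least two vertices we have $\frac12\le D(T)\le\frac34$, and the set of values $\{D(T) : T \text{ a finite series-reduced tree with } |T|\ge 2\}$ is dense in the interval $[\frac12,\frac34]$. -/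

import Mathlib

namespace SubtreeDensity

/-- The (finite) set of all subtrees of a finite graph `T`: the subgraphs of `T` that are trees.
Trees are connected, hence nonempty, so the empty subgraph is not a subtree. -/
noncomputable def subtrees {V : Type*} [Finite V] (T : SimpleGraph V) : Finset T.Subgraph :=
  (Set.toFinite {S : T.Subgraph | S.coe.IsTree}).toFinset

/-- The number `N(T)` of subtrees of `T`. -/
noncomputable def numSubtrees {V : Type*} [Finite V] (T : SimpleGraph V) : ℕ :=
  (subtrees T).card

/-- The average subtree order `μ(T)`: the average number of vertices over all subtrees of `T`. -/
noncomputable def meanSubtreeOrder {V : Type*} [Finite V] (T : SimpleGraph V) : ℝ :=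
  (∑ S ∈ subtrees T, (S.verts.ncard : ℝ)) / (numSubtrees T : ℝ)

/-- The subtree density `D(T) = μ(T) / |T|`. -/
noncomputable def density {V : Type*} [Finite V] (T : SimpleGraph V) : ℝ :=
  meanSubtreeOrder T / (Nat.card V : ℝ)

/-- A graph is series-reduced if it has no vertex of degree `2`. -/
def IsSeriesReduced {V : Type*} (T : SimpleGraph V) : Prop :=
  ∀ v : V, (T.neighborSet v).ncard ≠ 2

end SubtreeDensity

/-! Cutting an edge at the root splits a rooted tree into two rooted trees, and every subtree lies
on one side or joins two rooted subtrees. Hence order `n`, number `N` and total order `S` of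
subtrees, together with their analogues `f`, `R` for subtrees through the root, obey a simple
recursion. It is carried by `GTree`; `Represents` transfers it to graphs. Every bound is then an
induction. The bound 1/3 comes from `(n + 2) N ≤ 3 S` (`size_mul_count_le`), an equality for paths;
the bound 1 is trivial. Series-reduced trees are rooted at a leaf. For 3/4, with `L` leaves the mean
subtree order is at most `n - L / 2` (`sum_le`), and a series-reduced tree has many leaves
(`Reduced.weight_le`). For 1/2, the system `Branch` is strong enough to be preserved when children
are attached (`Reduced.branch`). Density on [1/3, 1] uses batons, long paths between two stars with
`k` leaves. If the path has about `2 ^ k / c` vertices, the density tends to `(c² + c + 1/6) / (c² +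
2c + 1/2)`, which takes every value in (1/3, 1). On [1/2, 3/4] it uses a star with `k` leaves joined
to a caterpillar with `l` spine vertices. Most subtrees contain almost the whole spine and about
half of the leaves, so the density is close to `(3l + k) / (2 (2l + k))`. -/

namespace SubtreeDensity

/-! ### Rooted trees, their subtree statistics and the bound 1/3 -/

/-- Rooted trees, built from a single root by attaching one rooted tree at a time
as a further child of the root. -/
inductive GTree where
  | single : GTree
  | graft : GTree → GTree → GTree

namespace GTree

/-- The number of vertices. -/
def size : GTree → ℕ
  | single => 1
  | graft t c => t.size + c.size

/-- The number of subtrees containing the root. -/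
noncomputable def rootCount : GTree → ℝ
  | single => 1
  | graft t c => t.rootCount * (1 + c.rootCount)

/-- The total number of vertices of the subtrees containing the root. -/
noncomputable def rootSum : GTree → ℝ
  | single => 1
  | graft t c => t.rootSum * (1 + c.rootCount) + t.rootCount * c.rootSum

/-- The number of subtrees. -/
noncomputable def count : GTree → ℝ
  | single => 1
  | graft t c => t.count + c.count + t.rootCount * c.rootCount

/-- The total number of vertices of the subtrees. -/
noncomputable def sum : GTree → ℝ
  | single => 1
  | graft t c => t.sum + c.sum + (t.rootSum * c.rootCount + t.rootCount * c.rootSum)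

/-- The number of children of the root. -/
def deg : GTree → ℕ
  | single => 0
  | graft t _ => t.deg + 1

/-- No vertex other than the root has degree two. -/
def Reduced : GTree → Prop
  | single => True
  | graft t c => t.Reduced ∧ c.Reduced ∧ c.deg ≠ 1

lemma one_le_size (b : GTree) : (1 : ℝ) ≤ b.size := by
  induction b with
  | single => simp [size]
  | graft t c ht hc => simp only [size]; push_cast; linarith

/-- The paths from the root to the vertices are distinct subtrees. -/
lemma size_le_rootCount (b : GTree) : (b.size : ℝ) ≤ b.rootCount := by
  induction b with
  | single => simp [size, rootCount]
  | graft t c ht hc =>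
    have h1 := t.one_le_size
    have h2 := c.one_le_size
    simp only [size, rootCount]; push_cast
    nlinarith

lemma one_le_rootCount (b : GTree) : 1 ≤ b.rootCount :=
  b.one_le_size.trans b.size_le_rootCount

/-- The mean order of a rooted subtree is at least `(n + 1) / 2`; paths rooted at an end and stars
rooted at the center give equality. -/
lemma le_rootSum (b : GTree) : ((b.size : ℝ) + 1) * b.rootCount ≤ 2 * b.rootSum := by
  induction b with
  | single => norm_num [size, rootCount, rootSum]
  | graft t c ht hc =>
    have h1 := t.one_le_rootCount
    have h2 := c.one_le_rootCount
    have h3 := c.size_le_rootCount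
    simp only [size, rootCount, rootSum]; push_cast
    nlinarith [mul_le_mul_of_nonneg_left h3 (zero_le_one.trans h1),
      mul_le_mul_of_nonneg_right ht (by linarith : 0 ≤ 1 + c.rootCount),
      mul_le_mul_of_nonneg_left hc (zero_le_one.trans h1)]

lemma rootCount_le_rootSum (b : GTree) : b.rootCount ≤ b.rootSum := by
  nlinarith [b.le_rootSum, b.one_le_size, b.one_le_rootCount]

/-- `rootSum` counts rooted subtrees with a marked vertex. Joining a subtree to the root by a path
and marking its top vertex is injective. -/
lemma count_le_rootSum (b : GTree) : b.count ≤ b.rootSum := by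
  induction b with
  | single => norm_num [count, rootSum]
  | graft t c ht hc =>
    have h1 := t.one_le_rootCount
    have h2 := c.one_le_rootCount
    have h3 := t.rootCount_le_rootSum
    have h4 := c.rootCount_le_rootSum
    simp only [count, rootSum]
    nlinarith

lemma rootCount_le_count (b : GTree) : b.rootCount ≤ b.count := by
  induction b with
  | single => norm_num [count, rootCount]
  | graft t c ht hc =>
    have h2 := c.one_le_rootCount
    simp only [count, rootCount]
    linarith

lemma one_le_count (b : GTree) : 1 ≤ b.count :=
  b.one_le_rootCount.trans b.rootCount_le_count

/-- In the induction the cross terms are bounded by `n₂ N₁ ≤ n₂ R₁ ≤ f₂ R₁` and its mirror image;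
`le_rootSum` pays for the subtrees meeting both sides. -/
lemma size_mul_count_le (b : GTree) : ((b.size : ℝ) + 2) * b.count ≤ 3 * b.sum := by
  induction b with
  | single => norm_num [size, count, sum]
  | graft t c ht hc =>
    have f1 := t.one_le_rootCount
    have f2 := c.one_le_rootCount
    have n1 := t.one_le_size
    have n2 := c.one_le_size
    have a1 := t.le_rootSum
    have a2 := c.le_rootSum
    have b1 := mul_le_mul_of_nonneg_left t.count_le_rootSum (zero_le_one.trans n2)
    have b2 := mul_le_mul_of_nonneg_left c.count_le_rootSum (zero_le_one.trans n1)
    have r1 : 0 ≤ t.rootSum := by linarith [t.rootCount_le_rootSum]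
    have r2 : 0 ≤ c.rootSum := by linarith [c.rootCount_le_rootSum]
    have c1 := mul_le_mul_of_nonneg_left c.size_le_rootCount r1
    have c2 := mul_le_mul_of_nonneg_left t.size_le_rootCount r2
    have d1 := mul_le_mul_of_nonneg_right a1 (zero_le_one.trans f2)
    have d2 := mul_le_mul_of_nonneg_right a2 (zero_le_one.trans f1)
    simp only [size, count, sum]; push_cast
    nlinarith

/-! ### The bound 3/4 for series-reduced trees -/

/-- Twice the number of vertices minus the number of leaves other than the root. -/
noncomputable def weight : GTree → ℝ
  | single => 2
  | graft t single => t.weight + 1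
  | graft t (graft c d) => t.weight + (graft c d).weight

lemma two_le_weight (b : GTree) : 2 ≤ b.weight := by
  fun_induction weight b <;> linarith

lemma rootSum_le (b : GTree) : 2 * b.rootSum ≤ b.weight * b.rootCount := by
  fun_induction weight b with
  | case1 => norm_num [rootSum, rootCount]
  | case2 t ht =>
    simp only [rootSum, rootCount]
    nlinarith [t.one_le_rootCount]
  | case3 t c d ht hc =>
    simp only [rootSum.eq_2 t, rootCount.eq_2 t]
    generalize graft c d = e at *
    have f1 := t.one_le_rootCount
    have f2 := e.one_le_rootCount
    nlinarith [mul_le_mul_of_nonneg_right ht (by linarith : 0 ≤ 1 + e.rootCount),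
      mul_le_mul_of_nonneg_left hc (by linarith : 0 ≤ t.rootCount),
      e.two_le_weight, mul_nonneg (by linarith : 0 ≤ t.rootCount) (by linarith [e.two_le_weight] : 0 ≤ e.weight)]

/-- Deleting a leaf pairs each larger subtree through it with one avoiding it, so a leaf contributes
about 1/2 to the mean and any other vertex at most 1. The induction absorbs the one-vertex subtrees.
-/
lemma sum_le (b : GTree) : 2 * b.sum ≤ b.weight * b.count := by
  fun_induction weight b with
  | case1 => norm_num [sum, count]
  | case2 t ht =>
    simp only [sum, count, rootSum, rootCount]
    nlinarith [t.one_le_rootCount, t.rootSum_le, t.rootCount_le_count, t.two_le_weight]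
  | case3 t c d ht hc =>
    simp only [sum.eq_2 t, count.eq_2 t]
    generalize graft c d = e at *
    have f1 := t.one_le_rootCount
    have f2 := e.one_le_rootCount
    have w1 := t.two_le_weight
    have w2 := e.two_le_weight
    nlinarith [mul_le_mul_of_nonneg_right t.rootSum_le (by linarith : 0 ≤ e.rootCount),
      mul_le_mul_of_nonneg_left e.rootSum_le (by linarith : 0 ≤ t.rootCount),
      mul_nonneg (by linarith : 0 ≤ t.weight) (by linarith [e.one_le_count] : 0 ≤ e.count),
      mul_nonneg (by linarith : 0 ≤ e.weight) (by linarith [t.one_le_count] : 0 ≤ t.count)]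

/-- With `L` non-root leaves this reads `n - 1 + deg ≤ 2 L`: count the `n - 1` non-root vertices as
children, at least two for each inner vertex other than the root. -/
lemma Reduced.weight_le {b : GTree} (h : b.Reduced) : 2 * b.weight + b.deg ≤ 3 * b.size + 1 := by
  fun_induction weight b with
  | case1 => norm_num [deg, size]
  | case2 t ht =>
    have := ht h.1
    simp only [deg, size]; push_cast; linarith
  | case3 t c d ht hc =>
    have h1 := ht h.1
    have h2 := hc h.2.1
    have h3 : (2 : ℝ) ≤ (graft c d).deg := by
      have := h.2.2
      simp only [deg] at this ⊢
      exact_mod_cast (by omega : 2 ≤ c.deg + 1)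
    simp only [deg.eq_2 t, size.eq_2 t]; push_cast; linarith

lemma Reduced.sum_le {b : GTree} (h : b.Reduced) (hd : 1 ≤ b.deg) :
    4 * b.sum ≤ 3 * (b.size * b.count) := by
  have h1 := h.weight_le
  have h2 : (1 : ℝ) ≤ b.deg := by exact_mod_cast hd
  nlinarith [b.sum_le, b.one_le_count]

/-! ### The bound 1/2 for series-reduced trees -/

/-- The inequalities satisfied by branches in which no vertex has exactly one child. -/
structure Branch (b : GTree) : Prop where
  three_le : (3 : ℝ) ≤ b.size
  count_le : 2 * b.count + b.size + 1 ≤ 4 * b.rootCount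
  -- This is density at least 1/2 for the tree obtained by hanging `b` below a new root of degree
  -- one.
  main : (b.size + 1) * b.count + (b.size - 1) * b.rootCount + b.size ≤
    2 * b.sum + 2 * b.rootSum + 1
  -- The first alternative is the cherry, a root with two leaves, where the growth estimate fails.
  large : (b.size = 3 ∧ b.rootCount = 4 ∧ b.rootSum = 8 ∧ b.count = 6 ∧ b.sum = 10) ∨
    2 * (b.size : ℝ) ≤ b.rootCount

lemma branch_cherry : Branch (graft (graft single single) single) := by
  constructor <;> norm_num [size, rootCount, rootSum, count, sum]

/-- The statistics ignore the order of the children, although the two orders are different terms. -/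
lemma Branch.swap {c₁ c₂ : GTree} (h : Branch (graft (graft single c₁) c₂)) :
    Branch (graft (graft single c₂) c₁) := by
  obtain ⟨h1, h2, h3, h4⟩ := h
  simp only [size, rootCount, rootSum, count, sum, Nat.cast_add, Nat.cast_one] at h1 h2 h3 h4
  constructor <;> simp only [size, rootCount, rootSum, count, sum, Nat.cast_add, Nat.cast_one]
  · linarith
  · linarith
  · linarith
  · rcases h4 with ⟨h4, h5, h6, h7, h8⟩ | h4
    · left; refine ⟨by omega, ?_, ?_, ?_, ?_⟩ <;> linarith
    · right; linarith

lemma Branch.single_graft {c : GTree} (h : Branch c) : Branch (graft (graft single single) c) := by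
  obtain ⟨h1, h2, h3, h4⟩ := h
  have h5 := c.le_rootSum
  have h6 := c.size_le_rootCount
  constructor <;> simp only [size, rootCount, rootSum, count, sum, Nat.cast_add, Nat.cast_one]
  · linarith
  · linarith
  · rcases h4 with ⟨h4, h5, h6, h7, h8⟩ | h4
    · rw [h4, h5, h6, h7, h8]; norm_num
    · linarith
  · right
    rcases h4 with ⟨h4, h5, h6, h7, h8⟩ | h4
    · rw [h4, h5]; norm_num
    · linarith

lemma Branch.graft_graft {c₁ c₂ : GTree} (h : Branch c₁) (h' : Branch c₂) :
    Branch (graft (graft single c₁) c₂) := by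
  obtain ⟨a1, a2, a3, a4⟩ := h
  obtain ⟨b1, b2, b3, b4⟩ := h'
  have a5 := c₁.le_rootSum
  have b5 := c₂.le_rootSum
  -- A weakening of `large` that also covers the cherry, with equality there.
  have a6 : 2 * (c₁.size : ℝ) - 2 ≤ c₁.rootCount := by
    rcases a4 with ⟨h4, h5, h6, h7, h8⟩ | h4
    · rw [h4, h5]; norm_num
    · linarith
  have b6 : 2 * (c₂.size : ℝ) - 2 ≤ c₂.rootCount := by
    rcases b4 with ⟨h4, h5, h6, h7, h8⟩ | h4
    · rw [h4, h5]; norm_num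
    · linarith
  clear a4 b4
  constructor <;> simp only [size, rootCount, rootSum, count, sum, Nat.cast_add, Nat.cast_one]
  · linarith
  · nlinarith
  · generalize (c₁.size : ℝ) = m₁ at *
    generalize (c₂.size : ℝ) = m₂ at *
    generalize c₁.rootCount = f₁ at *
    generalize c₂.rootCount = f₂ at *
    have k1 := mul_le_mul_of_nonneg_left a2 (by linarith : 0 ≤ m₂ + 1)
    have k2 := mul_le_mul_of_nonneg_left b2 (by linarith : 0 ≤ m₁ + 1)
    have k3 := mul_le_mul_of_nonneg_left a5 (by linarith : 0 ≤ 2 * f₂ + 1)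
    have k4 := mul_le_mul_of_nonneg_left b5 (by linarith : 0 ≤ 2 * f₁ + 1)
    have k5 := mul_nonneg (sub_nonneg.2 a6) (sub_nonneg.2 b6)
    have k6 := mul_nonneg (sub_nonneg.2 a6) (sub_nonneg.2 b1)
    have k7 := mul_nonneg (sub_nonneg.2 b6) (sub_nonneg.2 a1)
    have k8 := mul_nonneg (sub_nonneg.2 a1) (sub_nonneg.2 b1)
    nlinarith
  · right; nlinarith

lemma Branch.graft_single {t : GTree} (h : Branch t) : Branch (graft t single) := by
  obtain ⟨a1, a2, a3, a4⟩ := h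
  have a5 := t.le_rootSum
  constructor <;> simp only [size, rootCount, rootSum, count, sum, Nat.cast_add, Nat.cast_one]
  · linarith
  · rcases a4 with ⟨h4, h5, h6, h7, h8⟩ | h4
    · rw [h4, h5, h7]; norm_num
    · linarith
  · rcases a4 with ⟨h4, h5, h6, h7, h8⟩ | h4
    · rw [h4, h5, h6, h7, h8]; norm_num
    · nlinarith
  · right
    rcases a4 with ⟨h4, h5, h6, h7, h8⟩ | h4
    · rw [h4, h5]; norm_num
    · linarith

lemma Branch.graft {t c : GTree} (h : Branch t) (h' : Branch c) : Branch (graft t c) := by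
  obtain ⟨a1, a2, a3, a4⟩ := h
  obtain ⟨b1, b2, b3, b4⟩ := h'
  have a5 := t.le_rootSum
  have b5 := c.le_rootSum
  -- Again an equality for the cherry.
  have a6 : (t.size : ℝ) + 1 ≤ t.rootCount := by
    rcases a4 with ⟨h4, h5, h6, h7, h8⟩ | h4
    · rw [h4, h5]; norm_num
    · linarith
  have a7 : 2 * (t.size : ℝ) - 2 ≤ t.rootCount := by
    rcases a4 with ⟨h4, h5, h6, h7, h8⟩ | h4
    · rw [h4, h5]; norm_num
    · linarith
  have b6 : 2 * (c.size : ℝ) - 2 ≤ c.rootCount := by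
    rcases b4 with ⟨h4, h5, h6, h7, h8⟩ | h4
    · rw [h4, h5]; norm_num
    · linarith
  clear a4 b4
  constructor <;> simp only [size, rootCount, rootSum, count, sum, Nat.cast_add]
  · linarith
  · nlinarith
  · generalize (t.size : ℝ) = n at *
    generalize (c.size : ℝ) = m at *
    generalize t.rootCount = f at *
    generalize c.rootCount = g at *
    have k1 := mul_le_mul_of_nonneg_left a2 (by linarith : 0 ≤ m)
    have k2 := mul_le_mul_of_nonneg_left b2 (by linarith : 0 ≤ n)
    have k3 := mul_le_mul_of_nonneg_left a5 (by linarith : 0 ≤ 2 * g)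
    have k4 := mul_le_mul_of_nonneg_left b5 (by linarith : 0 ≤ 2 * f - 1)
    have k5 := mul_nonneg (sub_nonneg.2 a6) (sub_nonneg.2 b6)
    have k6 := mul_nonneg (sub_nonneg.2 a6) (sub_nonneg.2 b1)
    have k7 := mul_nonneg (sub_nonneg.2 b6) (sub_nonneg.2 a1)
    have k8 := mul_nonneg (sub_nonneg.2 a1) (sub_nonneg.2 b1)
    nlinarith
  · right; nlinarith

/-- A root with three or more children keeps two when the last is removed, so the base case is two
children. A child that is not a leaf has at least two children of its own. -/
lemma Reduced.branch : ∀ {b : GTree}, b.Reduced → 2 ≤ b.deg → Branch b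
  | single, _, hd => by simp [deg] at hd
  | .graft single _, _, hd => by simp [deg] at hd
  | .graft (.graft single single) single, _, _ => branch_cherry
  | .graft (.graft single single) (.graft c d), h, _ =>
    (Reduced.branch h.2.1 (by have := h.2.2; simp only [deg] at this ⊢; omega)).single_graft
  | .graft (.graft single (.graft c d)) single, h, _ =>
    (Reduced.branch h.1.2.1
      (by have := h.1.2.2; simp only [deg] at this ⊢; omega)).single_graft.swap
  | .graft (.graft single (.graft a b)) (.graft c d), h, _ =>
    (Reduced.branch h.1.2.1 (by have := h.1.2.2; simp only [deg] at this ⊢; omega)).graft_graft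
    (Reduced.branch h.2.1 (by have := h.2.2; simp only [deg] at this ⊢; omega))
  | .graft (.graft (.graft t c₁) c₂) single, h, _ =>
    (Reduced.branch h.1 (by simp [deg])).graft_single
  | .graft (.graft (.graft t c₁) c₂) (.graft c d), h, _ =>
    (Reduced.branch h.1 (by simp [deg])).graft
    (Reduced.branch h.2.1 (by have := h.2.2; simp only [deg] at this ⊢; omega))

lemma Reduced.le_sum : ∀ {b : GTree}, b.Reduced → b.deg = 1 → b.size * b.count ≤ 2 * b.sum
  | single, _, hd => by simp [deg] at hd
  | .graft (.graft _ _) _, _, hd => by simp [deg] at hd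
  | .graft single single, _, _ => by norm_num [size, count, sum, rootCount, rootSum]
  | .graft single (.graft c d), h, _ => by
    have hb := (Reduced.branch h.2.1 (by have := h.2.2; simp only [deg] at this ⊢; omega))
    rw [size, count, sum]
    generalize GTree.graft c d = e at *
    have := hb.main
    simp only [size, count, sum, rootCount, rootSum]; push_cast
    linarith

end GTree

end SubtreeDensity

/-! ### Connectivity and grafting of graphs -/

namespace SubtreeDensity

open Finset

universe u w

section Connectivity

variable {V : Type u} {W : Type w} {G : SimpleGraph V} {H : SimpleGraph W}

/-- Edges may be collapsed as well as preserved; this serves for isomorphisms, inclusions and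
shrinking one side of an edge to a point. -/
lemma reachable_of_contraction (f : V → W)
    (hf : ∀ x y, G.Adj x y → f x = f y ∨ H.Adj (f x) (f y)) {x y : V} (h : G.Reachable x y) :
    H.Reachable (f x) (f y) := by
  obtain ⟨p⟩ := h
  induction p with
  | nil => rfl
  | cons h _ ih =>
    rcases hf _ _ h with h | h
    · rwa [h]
    · exact h.reachable.trans ih

lemma connected_of_contraction (f : V → W)
    (hf : ∀ x y, G.Adj x y → f x = f y ∨ H.Adj (f x) (f y)) (hs : f.Surjective)
    (h : G.Connected) : H.Connected := by
  have := h.nonempty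
  refine (SimpleGraph.connected_iff _).2 ⟨fun a b => ?_, this.map f⟩
  obtain ⟨x, rfl⟩ := hs a
  obtain ⟨y, rfl⟩ := hs b
  exact reachable_of_contraction f hf (h.preconnected x y)

lemma connected_induce_map {G : SimpleGraph V} {H : SimpleGraph W} (φ : G ≃g H) (s : Finset V)
    (h : (G.induce (s : Set V)).Connected) :
    (H.induce ((s.map φ.toEquiv.toEmbedding : Finset W) : Set W)).Connected := by
  refine connected_of_contraction (fun x => ⟨φ x.1, by simp⟩) ?_ ?_ h
  · intro x y hxy
    exact Or.inr (φ.map_adj_iff.2 hxy)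
  · rintro ⟨y, hy⟩
    obtain ⟨x, hx, rfl⟩ := Finset.mem_map.1 hy
    exact ⟨⟨x, hx⟩, rfl⟩

lemma ncard_neighborSet_iso {G : SimpleGraph V} {H : SimpleGraph W} (φ : G ≃g H) (v : V) :
    (H.neighborSet (φ v)).ncard = (G.neighborSet v).ncard := by
  have : H.neighborSet (φ v) = φ '' G.neighborSet v := by
    ext x
    obtain ⟨y, rfl⟩ := φ.surjective x
    simp [φ.map_adj_iff]
  rw [this, Set.ncard_image_of_injective _ φ.injective]

end Connectivity

section Graft

variable {V : Type u} {W : Type w}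

/-- The disjoint union of two rooted graphs with an edge joining the roots. -/
def graftGraph (G : SimpleGraph V) (v : V) (H : SimpleGraph W) (u : W) : SimpleGraph (V ⊕ W) :=
  (G ⊕g H) ⊔ SimpleGraph.edge (Sum.inl v) (Sum.inr u)

variable {G : SimpleGraph V} {v : V} {H : SimpleGraph W} {u : W}

@[simp] lemma graftGraph_adj_inl_inl {a b : V} :
    (graftGraph G v H u).Adj (Sum.inl a) (Sum.inl b) ↔ G.Adj a b := by
  simp [graftGraph, SimpleGraph.edge_adj]

@[simp] lemma graftGraph_adj_inr_inr {a b : W} :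
    (graftGraph G v H u).Adj (Sum.inr a) (Sum.inr b) ↔ H.Adj a b := by
  simp [graftGraph, SimpleGraph.edge_adj]

@[simp] lemma graftGraph_adj_inl_inr {a : V} {b : W} :
    (graftGraph G v H u).Adj (Sum.inl a) (Sum.inr b) ↔ a = v ∧ b = u := by
  simp [graftGraph, SimpleGraph.edge_adj]

@[simp] lemma graftGraph_adj_inr_inl {a : V} {b : W} :
    (graftGraph G v H u).Adj (Sum.inr b) (Sum.inl a) ↔ a = v ∧ b = u := by
  rw [SimpleGraph.adj_comm, graftGraph_adj_inl_inr]

lemma isAcyclic_sum (hG : G.IsAcyclic) (hH : H.IsAcyclic) : (G ⊕g H).IsAcyclic := by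
  rw [SimpleGraph.isAcyclic_iff_forall_adj_isBridge] at *
  rintro (a | a) (b | b) hab
  · intro h
    refine hG (by simpa using hab) (reachable_of_contraction (Sum.elim id fun _ => a) ?_ h)
    rintro (x | x) (y | y) <;> simp; tauto
  · simp at hab
  · simp at hab
  · intro h
    refine hH (by simpa using hab) (reachable_of_contraction (Sum.elim (fun _ => a) id) ?_ h)
    rintro (x | x) (y | y) <;> simp; tauto

lemma isTree_graftGraph (hG : G.IsTree) (hH : H.IsTree) : (graftGraph G v H u).IsTree :=
  ⟨hG.1.sum_sup_edge hH.1, (isAcyclic_sum hG.2 hH.2).sup_edge_of_not_reachable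
    (SimpleGraph.not_reachable_sum_inl_inr v u)⟩

/-- A walk from one side to the other must cross the single joining edge. -/
lemma mem_of_connected_induce_graftGraph {s : Finset V} {t : Finset W}
    (h : ((graftGraph G v H u).induce (s.disjSum t : Set (V ⊕ W))).Connected)
    (hs : s.Nonempty) (ht : t.Nonempty) : v ∈ s ∧ u ∈ t := by
  obtain ⟨a, ha⟩ := hs
  obtain ⟨b, hb⟩ := ht
  obtain ⟨p⟩ := h.preconnected ⟨Sum.inl a, by simpa⟩ ⟨Sum.inr b, by simpa⟩
  obtain ⟨⟨⟨⟨x, hx⟩, ⟨y, hy⟩⟩, hadj⟩, -, h1, h2⟩ :=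
    p.exists_boundary_dart {x | x.1.isLeft} (by simp) (by simp)
  rcases x with x | x <;> rcases y with y | y <;> simp at h1 h2
  simp at hadj hx hy
  exact ⟨hadj.1 ▸ hx, hadj.2 ▸ hy⟩

lemma connected_induce_left {s : Finset V} {t : Finset W}
    (h : ((graftGraph G v H u).induce (s.disjSum t : Set (V ⊕ W))).Connected)
    (hs : s.Nonempty) : (G.induce (s : Set V)).Connected := by
  classical
  obtain ⟨a, ha⟩ := hs
  refine connected_of_contraction (fun x => match x with
    | ⟨Sum.inl x, hx⟩ => ⟨x, by simpa using hx⟩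
    -- The far side collapses to the root `v`. If `v ∉ s`, no edge crosses and any target will do.
    | ⟨Sum.inr _, _⟩ => if hv : v ∈ s then ⟨v, hv⟩ else ⟨a, ha⟩) ?_ ?_ h
  · rintro ⟨x | x, hx⟩ ⟨y | y, hy⟩ hxy <;> simp at hxy hx hy ⊢
    · exact Or.inr hxy
    · obtain ⟨rfl, rfl⟩ := hxy
      left; simp [hx]
    · obtain ⟨rfl, rfl⟩ := hxy
      left; simp [hy]
  · rintro ⟨x, hx⟩
    exact ⟨⟨Sum.inl x, by simpa using hx⟩, rfl⟩

lemma connected_induce_right {s : Finset V} {t : Finset W}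
    (h : ((graftGraph G v H u).induce (s.disjSum t : Set (V ⊕ W))).Connected)
    (ht : t.Nonempty) : (H.induce (t : Set W)).Connected := by
  classical
  obtain ⟨a, ha⟩ := ht
  refine connected_of_contraction (fun x => match x with
    | ⟨Sum.inr x, hx⟩ => ⟨x, by simpa using hx⟩
    | ⟨Sum.inl _, _⟩ => if hv : u ∈ t then ⟨u, hv⟩ else ⟨a, ha⟩) ?_ ?_ h
  · rintro ⟨x | x, hx⟩ ⟨y | y, hy⟩ hxy <;> simp at hxy hx hy ⊢
    · obtain ⟨rfl, rfl⟩ := hxy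
      left; simp [hy]
    · obtain ⟨rfl, rfl⟩ := hxy
      left; simp [hx]
    · exact Or.inr hxy
  · rintro ⟨x, hx⟩
    exact ⟨⟨Sum.inr x, by simpa using hx⟩, rfl⟩

lemma connected_induce_disjSum_empty {s : Finset V} :
    ((graftGraph G v H u).induce (s.disjSum (∅ : Finset W) : Set (V ⊕ W))).Connected ↔
      (G.induce (s : Set V)).Connected := by
  constructor
  · intro h
    obtain ⟨⟨x | x, hx⟩⟩ := h.nonempty
    · exact connected_induce_left h ⟨x, by simpa using hx⟩
    · simp at hx
  · intro h
    refine connected_of_contraction (fun x => ⟨Sum.inl x.1, by simp⟩) ?_ ?_ h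
    · rintro ⟨x, hx⟩ ⟨y, hy⟩ hxy
      right; simpa using hxy
    · rintro ⟨x | x, hx⟩
      · exact ⟨⟨x, by simpa using hx⟩, rfl⟩
      · simp at hx

lemma connected_induce_empty_disjSum {t : Finset W} :
    ((graftGraph G v H u).induce ((∅ : Finset V).disjSum t : Set (V ⊕ W))).Connected ↔
      (H.induce (t : Set W)).Connected := by
  constructor
  · intro h
    obtain ⟨⟨x | x, hx⟩⟩ := h.nonempty
    · simp at hx
    · exact connected_induce_right h ⟨x, by simpa using hx⟩
  · intro h
    refine connected_of_contraction (fun x => ⟨Sum.inr x.1, by simp⟩) ?_ ?_ h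
    · rintro ⟨x, hx⟩ ⟨y, hy⟩ hxy
      right; simpa using hxy
    · rintro ⟨x | x, hx⟩
      · simp at hx
      · exact ⟨⟨x, by simpa using hx⟩, rfl⟩

lemma connected_induce_disjSum {s : Finset V} {t : Finset W}
    (hs : (G.induce (s : Set V)).Connected) (ht : (H.induce (t : Set W)).Connected)
    (hv : v ∈ s) (hu : u ∈ t) :
    ((graftGraph G v H u).induce (s.disjSum t : Set (V ⊕ W))).Connected := by
  have key : ∀ x : (s.disjSum t : Set (V ⊕ W)),
      ((graftGraph G v H u).induce (s.disjSum t : Set (V ⊕ W))).Reachable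
        ⟨Sum.inl v, by simpa⟩ x := by
    rintro ⟨x | x, hx⟩
    · refine reachable_of_contraction (G := G.induce (s : Set V))
        (H := (graftGraph G v H u).induce (s.disjSum t : Set (V ⊕ W)))
        (fun y => ⟨Sum.inl y.1, by simp⟩) ?_ (x := ⟨v, hv⟩) (y := ⟨x, by simpa using hx⟩)
        (hs.preconnected _ _)
      intro x y hxy
      right; simpa using hxy
    · refine SimpleGraph.Reachable.trans (v := ⟨Sum.inr u, by simpa⟩)
        (SimpleGraph.Adj.reachable (by simp)) ?_
      refine reachable_of_contraction (G := H.induce (t : Set W))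
        (H := (graftGraph G v H u).induce (s.disjSum t : Set (V ⊕ W)))
        (fun y => ⟨Sum.inr y.1, by simp⟩) ?_ (x := ⟨u, hu⟩) (y := ⟨x, by simpa using hx⟩)
        (ht.preconnected _ _)
      intro x y hxy
      right; simpa using hxy
  exact (SimpleGraph.connected_iff _).2 ⟨fun x y => (key x).symm.trans (key y),
    ⟨Sum.inl v, by simpa⟩⟩

lemma ncard_neighborSet_inl_root [Finite V] [Finite W] :
    ((graftGraph G v H u).neighborSet (Sum.inl v)).ncard = (G.neighborSet v).ncard + 1 := by
  have : (graftGraph G v H u).neighborSet (Sum.inl v) =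
      insert (Sum.inr u) (Sum.inl '' G.neighborSet v) := by
    ext (x | x) <;> simp
  rw [this, Set.ncard_insert_of_notMem (by simp), Set.ncard_image_of_injective _ Sum.inl_injective]

lemma ncard_neighborSet_inr_root [Finite V] [Finite W] :
    ((graftGraph G v H u).neighborSet (Sum.inr u)).ncard = (H.neighborSet u).ncard + 1 := by
  have : (graftGraph G v H u).neighborSet (Sum.inr u) =
      insert (Sum.inl v) (Sum.inr '' H.neighborSet u) := by
    ext (x | x) <;> simp
  rw [this, Set.ncard_insert_of_notMem (by simp), Set.ncard_image_of_injective _ Sum.inr_injective]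

lemma ncard_neighborSet_inl {a : V} (ha : a ≠ v) :
    ((graftGraph G v H u).neighborSet (Sum.inl a)).ncard = (G.neighborSet a).ncard := by
  have : (graftGraph G v H u).neighborSet (Sum.inl a) = Sum.inl '' G.neighborSet a := by
    ext (x | x) <;> simp [ha]
  rw [this, Set.ncard_image_of_injective _ Sum.inl_injective]

lemma ncard_neighborSet_inr {b : W} (hb : b ≠ u) :
    ((graftGraph G v H u).neighborSet (Sum.inr b)).ncard = (H.neighborSet b).ncard := by
  have : (graftGraph G v H u).neighborSet (Sum.inr b) = Sum.inr '' H.neighborSet b := by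
    ext (x | x) <;> simp [hb]
  rw [this, Set.ncard_image_of_injective _ Sum.inr_injective]

end Graft

/-! ### The recursion for connected vertex sets -/

section ConnSets

variable {V : Type u} {W : Type w}

lemma nonempty_of_connected_induce {G : SimpleGraph V} {s : Finset V}
    (h : (G.induce (s : Set V)).Connected) : s.Nonempty := by
  obtain ⟨⟨x, hx⟩⟩ := h.nonempty
  exact ⟨x, hx⟩

variable [Fintype V] [Fintype W]

/-- The vertex sets inducing connected subgraphs. -/
noncomputable def connSets (G : SimpleGraph V) : Finset (Finset V) :=
  open Classical in univ.filter fun s => (G.induce (s : Set V)).Connected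

/-- The vertex sets containing `v` and inducing connected subgraphs. -/
noncomputable def connSetsAt (G : SimpleGraph V) (v : V) : Finset (Finset V) :=
  open Classical in (connSets G).filter (v ∈ ·)

@[simp] lemma mem_connSets {G : SimpleGraph V} {s : Finset V} :
    s ∈ connSets G ↔ (G.induce (s : Set V)).Connected := by
  simp [connSets]

@[simp] lemma mem_connSetsAt {G : SimpleGraph V} {v : V} {s : Finset V} :
    s ∈ connSetsAt G v ↔ (G.induce (s : Set V)).Connected ∧ v ∈ s := by
  simp [connSetsAt]

variable (G : SimpleGraph V) (v : V) (H : SimpleGraph W) (u : W)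

lemma sum_connSetsAt_graftGraph (F : Finset (V ⊕ W) → ℝ) :
    ∑ S ∈ connSetsAt (graftGraph G v H u) (Sum.inl v), F S =
      ∑ s ∈ connSetsAt G v, F (s.disjSum ∅) +
      ∑ s ∈ connSetsAt G v, ∑ t ∈ connSetsAt H u, F (s.disjSum t) := by
  classical
  have : connSetsAt (graftGraph G v H u) (Sum.inl v) =
      (connSetsAt G v).image (fun s => s.disjSum ∅) ∪
      (connSetsAt G v ×ˢ connSetsAt H u).image (fun p => p.1.disjSum p.2) := by
    ext S
    obtain ⟨s, t, rfl⟩ : ∃ s t, S = Finset.disjSum s t := ⟨_, _, toLeft_disjSum_toRight.symm⟩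
    simp only [mem_connSetsAt, inl_mem_disjSum, mem_union, mem_image, mem_product, Prod.exists,
      disjSum_inj]
    constructor
    · rintro ⟨h, hv⟩
      rcases t.eq_empty_or_nonempty with rfl | ht
      · exact Or.inl ⟨s, ⟨connected_induce_disjSum_empty.1 h, hv⟩, rfl, rfl⟩
      · exact Or.inr ⟨s, t, ⟨⟨connected_induce_left h ⟨v, hv⟩, hv⟩, connected_induce_right h ht,
          (mem_of_connected_induce_graftGraph h ⟨v, hv⟩ ht).2⟩, rfl, rfl⟩
    · rintro (⟨s, ⟨h, hv⟩, rfl, rfl⟩ | ⟨s, t, ⟨⟨h, hv⟩, h', hu⟩, rfl, rfl⟩)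
      · exact ⟨connected_induce_disjSum_empty.2 h, hv⟩
      · exact ⟨connected_induce_disjSum h h' hv hu, hv⟩
  rw [this, sum_union, sum_image, sum_image, sum_product]
  · rintro ⟨a, b⟩ - ⟨c, d⟩ - h
    simpa using h
  · intro a _ b _ h
    simpa using h
  · rw [disjoint_left]
    simp only [mem_image, mem_product, mem_connSetsAt, Prod.exists, not_exists]
    rintro _ ⟨s, -, rfl⟩ a b ⟨⟨-, -, hb⟩, h⟩
    rw [disjSum_inj] at h
    simp [h.2] at hb

lemma sum_connSets_graftGraph (F : Finset (V ⊕ W) → ℝ) :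
    ∑ S ∈ connSets (graftGraph G v H u), F S =
      ∑ s ∈ connSets G, F (s.disjSum ∅) + ∑ t ∈ connSets H, F (Finset.disjSum ∅ t) +
      ∑ s ∈ connSetsAt G v, ∑ t ∈ connSetsAt H u, F (s.disjSum t) := by
  classical
  have : connSets (graftGraph G v H u) =
      ((connSets G).image (fun s => s.disjSum ∅) ∪
      (connSets H).image (fun t => Finset.disjSum ∅ t)) ∪
      (connSetsAt G v ×ˢ connSetsAt H u).image (fun p => p.1.disjSum p.2) := by
    ext S
    obtain ⟨s, t, rfl⟩ : ∃ s t, S = Finset.disjSum s t := ⟨_, _, toLeft_disjSum_toRight.symm⟩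
    simp only [mem_connSets, mem_connSetsAt, mem_union, mem_image, mem_product, Prod.exists,
      disjSum_inj]
    constructor
    · intro h
      rcases t.eq_empty_or_nonempty with rfl | ht
      · exact Or.inl (Or.inl ⟨s, connected_induce_disjSum_empty.1 h, rfl, rfl⟩)
      rcases s.eq_empty_or_nonempty with rfl | hs
      · exact Or.inl (Or.inr ⟨t, connected_induce_empty_disjSum.1 h, rfl, rfl⟩)
      · have := mem_of_connected_induce_graftGraph h hs ht
        exact Or.inr ⟨s, t, ⟨⟨connected_induce_left h hs, this.1⟩, connected_induce_right h ht,
          this.2⟩, rfl, rfl⟩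
    · rintro ((⟨s, h, rfl, rfl⟩ | ⟨t, h, rfl, rfl⟩) | ⟨s, t, ⟨⟨h, hv⟩, h', hu⟩, rfl, rfl⟩)
      · exact connected_induce_disjSum_empty.2 h
      · exact connected_induce_empty_disjSum.2 h
      · exact connected_induce_disjSum h h' hv hu
  rw [this, sum_union, sum_union, sum_image, sum_image, sum_image, sum_product]
  · rintro ⟨a, b⟩ - ⟨c, d⟩ - h
    simpa using h
  · intro a _ b _ h
    simpa using h
  · intro a _ b _ h
    simpa using h
  · rw [disjoint_left]
    simp only [mem_image, mem_connSets, not_exists, not_and]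
    rintro _ ⟨s, hs, rfl⟩ t ht h
    rw [disjSum_inj] at h
    exact (nonempty_of_connected_induce ht).ne_empty h.2
  · rw [disjoint_left]
    simp only [mem_image, mem_union, mem_product, mem_connSetsAt, Prod.exists, not_exists]
    rintro _ (⟨s, -, rfl⟩ | ⟨s, -, rfl⟩) a b ⟨⟨⟨-, ha⟩, -, hb⟩, h⟩ <;> rw [disjSum_inj] at h
    · simp [h.2] at hb
    · simp [h.1] at ha

end ConnSets

/-! ### Transfer between graphs and abstract rooted trees -/

section Represents

variable {V : Type u} {W : Type w} [Fintype V] [Fintype W]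

/-- The tree `G` with root `v` has the same statistics as the abstract rooted tree `b`. -/
structure Represents (G : SimpleGraph V) (v : V) (b : GTree) : Prop where
  isTree : G.IsTree
  size : Nat.card V = b.size
  rootCount : ∑ _s ∈ connSetsAt G v, (1 : ℝ) = b.rootCount
  rootSum : ∑ s ∈ connSetsAt G v, (#s : ℝ) = b.rootSum
  count : ∑ _s ∈ connSets G, (1 : ℝ) = b.count
  sum : ∑ s ∈ connSets G, (#s : ℝ) = b.sum
  deg : (G.neighborSet v).ncard = b.deg
  reduced : (∀ x ≠ v, (G.neighborSet x).ncard ≠ 2) ↔ b.Reduced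

lemma Represents.graftGraph {G : SimpleGraph V} {v : V} {b : GTree} (h : Represents G v b)
    {H : SimpleGraph W} {u : W} {c : GTree} (h' : Represents H u c) :
    Represents (graftGraph G v H u) (Sum.inl v) (GTree.graft b c) where
  isTree := isTree_graftGraph h.isTree h'.isTree
  size := by
    have := h.isTree
    rw [Nat.card_sum, h.size, h'.size, GTree.size]
  rootCount := by
    rw [sum_connSetsAt_graftGraph]
    rw [h'.rootCount, GTree.rootCount, ← h.rootCount]
    simp; ring
  rootSum := by
    rw [sum_connSetsAt_graftGraph]
    simp only [card_disjSum, card_empty, Nat.cast_add, sum_add_distrib, h'.rootSum]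
    rw [GTree.rootSum, ← h.rootCount, ← h.rootSum, ← h'.rootCount]
    simp [← sum_mul, mul_comm]; ring
  count := by
    rw [sum_connSets_graftGraph, h.count, h'.count, h'.rootCount, GTree.count, ← h.rootCount]
    simp
  sum := by
    rw [sum_connSets_graftGraph]
    simp only [card_disjSum, card_empty, Nat.cast_add, sum_add_distrib, h'.rootSum]
    rw [GTree.sum, ← h.rootCount, ← h.rootSum, ← h.sum, ← h'.sum, ← h'.rootCount]
    simp [← sum_mul, mul_comm]
  deg := by rw [ncard_neighborSet_inl_root, h.deg, GTree.deg]
  reduced := by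
    rw [GTree.Reduced, ← h.reduced, ← h'.reduced, ← h'.deg]
    constructor
    · intro hx
      refine ⟨fun x hxv => ?_, fun x hxu => ?_, ?_⟩
      · rw [← ncard_neighborSet_inl (H := H) (u := u) hxv]
        exact hx _ (by simpa)
      · rw [← ncard_neighborSet_inr (G := G) (v := v) hxu]
        exact hx _ (by simp)
      · have := hx (Sum.inr u) (by simp)
        rw [ncard_neighborSet_inr_root] at this
        omega
    · rintro ⟨h1, h2, h3⟩ (x | x) hx
      · have hx : x ≠ v := by simpa using hx
        rw [ncard_neighborSet_inl hx]
        exact h1 x hx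
      · by_cases hu : x = u
        · subst hu
          rw [ncard_neighborSet_inr_root]
          omega
        · rw [ncard_neighborSet_inr hu]
          exact h2 x hu

lemma sum_connSets_iso {G : SimpleGraph V} {H : SimpleGraph W} (φ : G ≃g H) (F : ℕ → ℝ) :
    ∑ s ∈ connSets G, F #s = ∑ s ∈ connSets H, F #s := by
  refine sum_bij' (fun s _ => s.map φ.toEquiv.toEmbedding)
    (fun s _ => s.map φ.symm.toEquiv.toEmbedding) ?_ ?_ ?_ ?_ ?_
  · intro s hs
    exact mem_connSets.2 (connected_induce_map φ s (mem_connSets.1 hs))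
  · intro s hs
    exact mem_connSets.2 (connected_induce_map φ.symm s (mem_connSets.1 hs))
  · intro s _
    ext x
    simp only [mem_map_equiv]
    exact iff_of_eq (congrArg (· ∈ s) (φ.symm_apply_apply x))
  · intro s _
    ext x
    simp only [mem_map_equiv]
    exact iff_of_eq (congrArg (· ∈ s) (φ.apply_symm_apply x))
  · intro s _; simp

lemma sum_connSetsAt_iso {G : SimpleGraph V} {H : SimpleGraph W} (φ : G ≃g H) (v : V)
    (F : ℕ → ℝ) : ∑ s ∈ connSetsAt G v, F #s = ∑ s ∈ connSetsAt H (φ v), F #s := by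
  refine sum_bij' (fun s _ => s.map φ.toEquiv.toEmbedding)
    (fun s _ => s.map φ.symm.toEquiv.toEmbedding) ?_ ?_ ?_ ?_ ?_
  · intro s hs
    rw [mem_connSetsAt] at *
    exact ⟨connected_induce_map φ s hs.1, mem_map_of_mem _ hs.2⟩
  · intro s hs
    rw [mem_connSetsAt] at *
    exact ⟨connected_induce_map φ.symm s hs.1, mem_map.2 ⟨_, hs.2, φ.symm_apply_apply v⟩⟩
  · intro s _
    ext x
    simp only [mem_map_equiv]
    exact iff_of_eq (congrArg (· ∈ s) (φ.symm_apply_apply x))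
  · intro s _
    ext x
    simp only [mem_map_equiv]
    exact iff_of_eq (congrArg (· ∈ s) (φ.apply_symm_apply x))
  · intro s _; simp

lemma Represents.iso {G : SimpleGraph V} {v : V} {b : GTree} (h : Represents G v b)
    {H : SimpleGraph W} (φ : G ≃g H) : Represents H (φ v) b where
  isTree := φ.isTree_iff.1 h.isTree
  size := by rw [← h.size, Nat.card_congr φ.toEquiv]
  rootCount := by rw [← h.rootCount, ← sum_connSetsAt_iso φ v fun _ => 1]
  rootSum := by rw [← h.rootSum, ← sum_connSetsAt_iso φ v fun n => n]
  count := by rw [← h.count, ← sum_connSets_iso φ fun _ => 1]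
  sum := by rw [← h.sum, ← sum_connSets_iso φ fun n => n]
  deg := by rw [ncard_neighborSet_iso, h.deg]
  reduced := by
    rw [← h.reduced, ← φ.toEquiv.forall_congr_right]
    simp [ncard_neighborSet_iso]

lemma represents_single [Subsingleton V] (G : SimpleGraph V) (v : V) :
    Represents G v GTree.single := by
  classical
  have : Nonempty V := ⟨v⟩
  have : Unique V := ⟨⟨v⟩, fun x => Subsingleton.elim _ _⟩
  have h1 : connSets G = {{v}} := by
    ext s
    rw [mem_connSets, mem_singleton]
    constructor
    · intro h
      obtain ⟨x, hx⟩ := nonempty_of_connected_induce h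
      ext y
      simp [Subsingleton.elim y v, Subsingleton.elim x v ▸ hx]
    · rintro rfl
      have : Nonempty (({v} : Finset V) : Set V) := ⟨⟨v, by simp⟩⟩
      exact (SimpleGraph.IsTree.of_subsingleton).1
  have h2 : connSetsAt G v = {{v}} := by
    ext s
    rw [mem_connSetsAt, ← mem_connSets, h1]
    simp +contextual
  refine ⟨SimpleGraph.IsTree.of_subsingleton, ?_, ?_, ?_, ?_, ?_, ?_, ?_⟩
  · simp [GTree.size]
  · simp [h2, GTree.rootCount]
  · simp [h2, GTree.rootSum]
  · simp [h1, GTree.count]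
  · simp [h1, GTree.sum]
  · simp [GTree.deg]
  · simp only [GTree.Reduced, iff_true]
    intro x hx
    exact absurd (Subsingleton.elim x v) hx

lemma exists_represents_fin (b : GTree) :
    ∃ (G : SimpleGraph (Fin b.size)) (v : Fin b.size), Represents G v b := by
  induction b with
  | single => exact ⟨⊥, (0 : Fin 1), represents_single (V := Fin 1) _ _⟩
  | graft b c hb hc =>
    obtain ⟨G, v, h⟩ := hb
    obtain ⟨H, u, h'⟩ := hc
    exact ⟨_, _, (h.graftGraph h').iso (SimpleGraph.Iso.map finSumFinEquiv _)⟩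

end Represents

section Decomposition

/-- Deleting an edge `vu` of a tree leaves two smaller trees, rooted at `v` and `u`, whose graft is
the original tree. -/
lemma exists_represents_aux (n : ℕ) : ∀ (V : Type u) [Fintype V] (G : SimpleGraph V),
    G.IsTree → Nat.card V = n → ∀ v : V, ∃ b, Represents G v b := by
  classical
  induction n using Nat.strong_induction_on with
  | _ n ih =>
    intro V _ G hG hn v
    rcases subsingleton_or_nontrivial V with hV | hV
    · exact ⟨_, represents_single G v⟩
    obtain ⟨u, hu⟩ : ∃ u, G.Adj v u := hG.1.preconnected.exists_adj_of_nontrivial v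
    let H := G.deleteEdges {s(v, u)}
    let p : V → Prop := fun w => H.Reachable v w
    have pv : p v := SimpleGraph.Reachable.refl v
    have pu : ¬ p u := SimpleGraph.isAcyclic_iff_forall_adj_isBridge.1 hG.2 hu
    -- `vu` is the only edge between the two components.
    have key : ∀ x y, p x → ¬ p y → G.Adj x y → x = v ∧ y = u := by
      intro x y hx hy hxy
      by_contra hne
      have hadj : H.Adj x y := by
        simp only [H, SimpleGraph.deleteEdges_adj, Set.mem_singleton_iff, Sym2.eq_iff]
        refine ⟨hxy, ?_⟩
        rintro (h | ⟨rfl, rfl⟩)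
        · exact hne h
        · exact hy pv
      exact hy (hx.trans hadj.reachable)
    have tree₁ : (G.induce {w | p w}).IsTree := by
      refine ⟨connected_of_contraction (fun x => if h : p x then ⟨x, h⟩ else ⟨v, pv⟩) ?_ ?_ hG.1,
        hG.2.induce _⟩
      · intro x y hxy
        by_cases hx : p x <;> by_cases hy : p y <;> simp only [hx, hy, dif_pos, dif_neg,
          not_false_eq_true]
        · exact Or.inr hxy
        · left; simp [(key x y hx hy hxy).1]
        · left; simp [(key y x hy hx hxy.symm).1]
        · exact Or.inl trivial
      · rintro ⟨x, hx⟩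
        exact ⟨x, dif_pos hx⟩
    have tree₂ : (G.induce {w | ¬ p w}).IsTree := by
      refine ⟨connected_of_contraction (fun x => if h : p x then ⟨u, pu⟩ else ⟨x, h⟩) ?_ ?_ hG.1,
        hG.2.induce _⟩
      · intro x y hxy
        by_cases hx : p x <;> by_cases hy : p y <;> simp only [hx, hy, dif_pos, dif_neg,
          not_false_eq_true]
        · exact Or.inl trivial
        · left; simp [(key x y hx hy hxy).2]
        · left; simp [(key y x hy hx hxy.symm).2]
        · exact Or.inr hxy
      · rintro ⟨x, hx⟩
        exact ⟨x, dif_neg hx⟩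
    have lt₁ : Nat.card {w | p w} < n := by
      rw [← hn, Nat.card_eq_fintype_card, Nat.card_eq_fintype_card]
      exact Fintype.card_subtype_lt pu
    have lt₂ : Nat.card {w | ¬ p w} < n := by
      rw [← hn, Nat.card_eq_fintype_card, Nat.card_eq_fintype_card]
      exact Fintype.card_subtype_lt (not_not.2 pv)
    obtain ⟨b, hb⟩ := ih _ lt₁ _ _ tree₁ rfl ⟨v, pv⟩
    obtain ⟨c, hc⟩ := ih _ lt₂ _ _ tree₂ rfl ⟨u, pu⟩
    have φ : ∃ φ : graftGraph (G.induce {w | p w}) ⟨v, pv⟩ (G.induce {w | ¬ p w}) ⟨u, pu⟩ ≃g G,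
        φ (Sum.inl ⟨v, pv⟩) = v := by
      refine ⟨⟨Equiv.sumCompl p, ?_⟩, rfl⟩
      have : ∀ x y, p x → ¬ p y → (G.Adj x y ↔ x = v ∧ y = u) := fun x y hx hy =>
        ⟨key x y hx hy, by rintro ⟨rfl, rfl⟩; exact hu⟩
      rintro (⟨x, hx⟩ | ⟨x, hx⟩) (⟨y, hy⟩ | ⟨y, hy⟩)
      · rw [graftGraph_adj_inl_inl]; rfl
      · rw [graftGraph_adj_inl_inr, Subtype.mk.injEq, Subtype.mk.injEq]
        exact this x y hx hy
      · rw [graftGraph_adj_inr_inl, Subtype.mk.injEq, Subtype.mk.injEq]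
        exact (G.adj_comm x y).trans (this y x hy hx)
      · rw [graftGraph_adj_inr_inr]; rfl
    obtain ⟨φ, hφ⟩ := φ
    exact ⟨_, hφ ▸ (hb.graftGraph hc).iso φ⟩

lemma exists_represents {V : Type u} [Fintype V] {G : SimpleGraph V} (hG : G.IsTree) (v : V) :
    ∃ b, Represents G v b :=
  exists_represents_aux _ V G hG rfl v

end Decomposition

/-! ### Subtree density and its bounds -/

section Density

variable {V : Type u} {T : SimpleGraph V}

/-- An edge of `T` missing from `S` between two vertices of `S` would not be a bridge, since `S`
joins its ends. So subtrees correspond to connected vertex sets. -/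
lemma isInduced_of_isTree (hT : T.IsAcyclic) {S : T.Subgraph} (hS : S.coe.IsTree) :
    S.IsInduced := by
  intro x hx y hy hxy
  by_contra h
  refine SimpleGraph.isAcyclic_iff_forall_adj_isBridge.1 hT hxy ?_
  refine reachable_of_contraction (G := S.coe) Subtype.val ?_ (hS.1.preconnected ⟨x, hx⟩ ⟨y, hy⟩)
  rintro ⟨a, ha⟩ ⟨b, hb⟩ hab
  right
  rw [SimpleGraph.Subgraph.coe_adj] at hab
  simp only [SimpleGraph.deleteEdges_adj, Set.mem_singleton_iff, Sym2.eq_iff]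
  refine ⟨hab.adj_sub, ?_⟩
  rintro (⟨rfl, rfl⟩ | ⟨rfl, rfl⟩)
  · exact h hab
  · exact h hab.symm

variable [Fintype V]

lemma sum_subtrees (hT : T.IsAcyclic) (F : ℕ → ℝ) :
    ∑ S ∈ subtrees T, F S.verts.ncard = ∑ s ∈ connSets T, F #s := by
  classical
  have hmem : ∀ S, S ∈ subtrees T ↔ S.coe.IsTree := by simp [subtrees]
  refine sum_bij' (fun S _ => S.verts.toFinset)
    (fun s _ => (⊤ : T.Subgraph).induce (s : Set V)) ?_ ?_ ?_ ?_ ?_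
  · intro S hS
    rw [hmem] at hS
    rw [mem_connSets, Set.coe_toFinset]
    convert hS.1 using 1
    ext x y
    exact ⟨fun h => isInduced_of_isTree hT hS x.2 y.2 h, fun h => h.adj_sub⟩
  · intro s hs
    rw [mem_connSets, SimpleGraph.induce_eq_coe_induce_top] at hs
    exact (hmem _).2 ⟨hs, hT.subgraph _⟩
  · intro S hS
    rw [hmem] at hS
    rw [Set.coe_toFinset, (isInduced_of_isTree hT hS).induce_top_verts]
  · intro s _
    simp
  · intro S _
    rw [Set.ncard_eq_toFinset_card']

lemma Represents.density_eq {v : V} {b : GTree} (h : Represents T v b) :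
    density T = b.sum / (b.size * b.count) := by
  have h1 : (numSubtrees T : ℝ) = b.count := by
    rw [← h.count, ← sum_subtrees h.isTree.2 fun _ => 1, numSubtrees]
    simp
  rw [density, meanSubtreeOrder, sum_subtrees h.isTree.2 fun n => n, h.sum, h1, h.size, div_div,
    mul_comm]

lemma Represents.isSeriesReduced_iff {v : V} {b : GTree} (h : Represents T v b) :
    IsSeriesReduced T ↔ b.Reduced ∧ b.deg ≠ 2 := by
  rw [← h.reduced, ← h.deg, IsSeriesReduced]
  constructor
  · exact fun hx => ⟨fun x _ => hx x, hx v⟩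
  · rintro ⟨h1, h2⟩ x
    by_cases hx : x = v
    · exact hx ▸ h2
    · exact h1 x hx

theorem density_mem_Icc (hT : T.IsTree) : density T ∈ Set.Icc (1 / 3 : ℝ) 1 := by
  obtain ⟨v⟩ := hT.1.nonempty
  obtain ⟨b, hb⟩ := exists_represents hT v
  have h1 : 0 < b.size * b.count := by nlinarith [b.one_le_size, b.one_le_count]
  have h2 : b.sum ≤ b.size * b.count := by
    rw [← hb.sum, ← hb.size, ← hb.count, mul_sum]
    refine sum_le_sum fun s _ => ?_
    rw [mul_one, Nat.card_eq_fintype_card]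
    exact_mod_cast card_le_univ s
  rw [hb.density_eq, Set.mem_Icc, le_div_iff₀ h1, div_le_iff₀ h1]
  constructor
  · nlinarith [b.size_mul_count_le, b.one_le_count]
  · linarith

theorem density_mem_Icc_of_isSeriesReduced (hT : T.IsTree) (hr : IsSeriesReduced T)
    (hV : 2 ≤ Nat.card V) : density T ∈ Set.Icc (1 / 2 : ℝ) (3 / 4) := by
  classical
  have : Nontrivial V := Finite.one_lt_card_iff_nontrivial.1 hV
  -- Rooting at a leaf gives `deg = 1`, as both bounds for reduced trees require.
  obtain ⟨v, hv⟩ := hT.exists_vert_degree_one_of_nontrivial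
  obtain ⟨b, hb⟩ := exists_represents hT v
  have hd : b.deg = 1 := by
    rw [← hb.deg, ← hv, Set.ncard_eq_toFinset_card', SimpleGraph.degree, SimpleGraph.neighborFinset]
  have h1 : 0 < b.size * b.count := by nlinarith [b.one_le_size, b.one_le_count]
  have h2 := (hb.isSeriesReduced_iff.1 hr).1
  rw [hb.density_eq, Set.mem_Icc, le_div_iff₀ h1, div_le_iff₀ h1]
  constructor
  · linarith [h2.le_sum hd]
  · linarith [h2.sum_le hd.ge]

end Density

end SubtreeDensity

/-! ### Density of the values: batons and caterpillars -/

namespace SubtreeDensity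

open Filter Topology

lemma GTree.density_mem (b : GTree) :
    b.sum / (b.size * b.count) ∈ {d : ℝ | ∃ (n : ℕ) (T : SimpleGraph (Fin n)),
      T.IsTree ∧ density T = d} := by
  obtain ⟨G, v, h⟩ := exists_represents_fin b
  exact ⟨_, G, h.isTree, h.density_eq⟩

lemma GTree.Reduced.density_mem {b : GTree} (hb : b.Reduced) (hd : b.deg ≠ 2) (hn : 2 ≤ b.size) :
    b.sum / (b.size * b.count) ∈ {d : ℝ | ∃ (n : ℕ) (T : SimpleGraph (Fin n)),
      T.IsTree ∧ IsSeriesReduced T ∧ 2 ≤ n ∧ density T = d} := by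
  obtain ⟨G, v, h⟩ := exists_represents_fin b
  exact ⟨_, G, h.isTree, h.isSeriesReduced_iff.2 ⟨hb, hd⟩, hn, h.density_eq⟩

namespace GTree

/-- Attach `k` leaves to the root. -/
def addLeaves (t : GTree) : ℕ → GTree
  | 0 => t
  | k + 1 => graft (t.addLeaves k) single

/-- Attach the root of `t` to the end of a path with `j` vertices. -/
def addPath (t : GTree) : ℕ → GTree
  | 0 => t
  | j + 1 => graft single (t.addPath j)

/-- Attach the root of `t` to the end of a path with `l` vertices, each of which carries a leaf. -/
def addCaterpillar (t : GTree) : ℕ → GTree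
  | 0 => t
  | l + 1 => graft (graft single single) (t.addCaterpillar l)

section addLeaves

variable (t : GTree) (k : ℕ)

lemma size_addLeaves : ((t.addLeaves k).size : ℝ) = t.size + k := by
  induction k with
  | zero => simp [addLeaves]
  | succ k ih => simp only [addLeaves, size, Nat.cast_add, ih]; push_cast; ring

lemma deg_addLeaves : (t.addLeaves k).deg = t.deg + k := by
  induction k with
  | zero => simp [addLeaves]
  | succ k ih => simp only [addLeaves, deg, ih]; ring

lemma rootCount_addLeaves : (t.addLeaves k).rootCount = 2 ^ k * t.rootCount := by
  induction k with
  | zero => simp [addLeaves]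
  | succ k ih => simp only [addLeaves, rootCount, ih]; ring

lemma rootSum_addLeaves :
    (t.addLeaves k).rootSum = 2 ^ k * (t.rootSum + k / 2 * t.rootCount) := by
  induction k with
  | zero => simp [addLeaves]
  | succ k ih =>
    simp only [addLeaves, rootSum, rootCount, ih, rootCount_addLeaves]; push_cast; ring

lemma count_addLeaves : (t.addLeaves k).count = t.count + (2 ^ k - 1) * t.rootCount + k := by
  induction k with
  | zero => simp [addLeaves]
  | succ k ih =>
    simp only [addLeaves, count, rootCount, ih, rootCount_addLeaves]; push_cast; ring

lemma sum_addLeaves : (t.addLeaves k).sum =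
    t.sum + (2 ^ k * (t.rootSum + k / 2 * t.rootCount) - t.rootSum) + k := by
  induction k with
  | zero => simp [addLeaves]
  | succ k ih =>
    simp only [addLeaves, sum, rootSum, rootCount, ih, rootCount_addLeaves, rootSum_addLeaves]
    push_cast; ring

lemma Reduced.addLeaves {t : GTree} (h : t.Reduced) : (t.addLeaves k).Reduced := by
  induction k with
  | zero => exact h
  | succ k ih => exact ⟨ih, trivial, by simp [deg]⟩

end addLeaves

section addPath

variable (t : GTree) (j : ℕ)

lemma size_addPath : ((t.addPath j).size : ℝ) = t.size + j := by
  induction j with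
  | zero => simp [addPath]
  | succ k ih => simp only [addPath, size, Nat.cast_add, ih]; push_cast; ring

lemma rootCount_addPath : (t.addPath j).rootCount = t.rootCount + j := by
  induction j with
  | zero => simp [addPath]
  | succ k ih => simp only [addPath, rootCount, ih]; push_cast; ring

lemma rootSum_addPath :
    (t.addPath j).rootSum = t.rootSum + j * t.rootCount + j * (j + 1) / 2 := by
  induction j with
  | zero => simp [addPath]
  | succ k ih => simp only [addPath, rootSum, rootCount, ih, rootCount_addPath]; push_cast; ring

lemma count_addPath : (t.addPath j).count = t.count + j * t.rootCount + j * (j + 1) / 2 := by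
  induction j with
  | zero => simp [addPath]
  | succ k ih => simp only [addPath, count, rootCount, ih, rootCount_addPath]; push_cast; ring

lemma sum_addPath : (t.addPath j).sum = t.sum + j * t.rootSum + j * (j + 1) / 2 * t.rootCount +
    j * (j + 1) * (j + 2) / 6 := by
  induction j with
  | zero => simp [addPath]
  | succ k ih =>
    simp only [addPath, sum, rootSum, rootCount, ih, rootCount_addPath, rootSum_addPath]
    push_cast; ring

end addPath

/-- A path with `j` vertices between the centers of two stars with `k` leaves each. -/
def baton (k j : ℕ) : GTree := ((single.addLeaves k).addPath j).addLeaves k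

/-- The density of `baton k j` in terms of `2 ^ k / j`, `k / j` and `1 / j`. -/
noncomputable def batonDensity (x : ℝ × ℝ × ℝ) : ℝ :=
  (x.1 * x.2.2 * (x.2.2 + x.2.1 / 2) + 2 * x.2.1 * x.2.2 ^ 2 + x.1 * (x.2.2 + x.2.1 / 2) +
    x.1 * (1 + x.2.2) / 2 + (1 + x.2.2) * (1 + 2 * x.2.2) / 6 +
    (x.1 - x.2.2) * (x.1 * (x.2.2 + x.2.1 / 2) + x.1 + (1 + x.2.2) / 2) +
    x.2.1 * x.1 / 2 * (x.1 + 1)) /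
  ((2 * x.2.1 + x.2.2 + 1) *
    (x.1 * x.2.2 + 2 * x.2.1 * x.2.2 + x.1 + (1 + x.2.2) / 2 + (x.1 - x.2.2) * (x.1 + 1)))

lemma density_baton (k j : ℕ) (hj : (j : ℝ) ≠ 0) :
    (baton k j).sum / ((baton k j).size * (baton k j).count) =
      batonDensity (2 ^ k / j, k / j, 1 / j) := by
  simp only [baton, batonDensity, size_addLeaves, size_addPath, rootCount_addLeaves,
    rootCount_addPath, rootSum_addLeaves, rootSum_addPath, count_addLeaves, count_addPath,
    sum_addLeaves, sum_addPath, size, rootCount, rootSum, count, sum]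
  generalize (2 : ℝ) ^ k = A
  generalize (j : ℝ) = y at *
  generalize (k : ℝ) = z
  -- The total order scales like `j ^ 3`, as does `size * count`.
  have hy : y ^ 3 ≠ 0 := pow_ne_zero 3 hj
  rw [← div_div_div_cancel_right₀ hy]
  congr 1
  · field_simp; ring
  · field_simp; ring

lemma continuousAt_batonDensity {c : ℝ} (hc : 0 < c) :
    ContinuousAt batonDensity (c, 0, 0) := by
  unfold batonDensity
  refine ContinuousAt.div (by fun_prop) (by fun_prop) ?_
  norm_num
  positivity

lemma batonDensity_mem_closure {c : ℝ} (hc : 0 < c) :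
    batonDensity (c, 0, 0) ∈ closure {d : ℝ | ∃ (n : ℕ) (T : SimpleGraph (Fin n)),
      T.IsTree ∧ density T = d} := by
  have hA : Tendsto (fun k : ℕ => (2 : ℝ) ^ k) atTop atTop :=
    tendsto_pow_atTop_atTop_of_one_lt one_lt_two
  -- The path length is `⌊2 ^ k / c⌋`, so that `2 ^ k / j → c` while `k / j` and `1 / j` vanish.
  have h0 : Tendsto (fun k : ℕ => (⌊c⁻¹ * 2 ^ k⌋₊ : ℝ) / 2 ^ k) atTop (𝓝 c⁻¹) :=
    (tendsto_nat_floor_mul_div_atTop (inv_nonneg.2 hc.le)).comp hA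
  have hu : Tendsto (fun k : ℕ => (2 : ℝ) ^ k / ⌊c⁻¹ * 2 ^ k⌋₊) atTop (𝓝 c) := by
    simpa using h0.inv₀ (inv_ne_zero hc.ne')
  have hv : Tendsto (fun k : ℕ => (k : ℝ) / ⌊c⁻¹ * 2 ^ k⌋₊) atTop (𝓝 0) := by
    have := (tendsto_pow_const_div_const_pow_of_one_lt 1 (one_lt_two (α := ℝ))).mul hu
    rw [zero_mul] at this
    refine this.congr fun k => ?_
    rw [pow_one, div_mul_div_cancel₀ (by positivity)]
  have hw : Tendsto (fun k : ℕ => 1 / (⌊c⁻¹ * 2 ^ k⌋₊ : ℝ)) atTop (𝓝 0) := by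
    have := hA.inv_tendsto_atTop.mul hu
    rw [zero_mul] at this
    refine this.congr fun k => ?_
    rw [Pi.inv_apply, inv_mul_eq_div, div_div_cancel_left' (by positivity), one_div]
  have hlim := (continuousAt_batonDensity hc).tendsto.comp
    (hu.prodMk_nhds (hv.prodMk_nhds hw))
  refine mem_closure_of_tendsto hlim ?_
  filter_upwards [h0.eventually_ne (inv_ne_zero hc.ne')] with k hk
  rw [Function.comp_apply, ← density_baton k _ fun h => hk (by rw [h, zero_div])]
  exact density_mem _

lemma exists_batonDensity_eq {x : ℝ} (hx : x ∈ Set.Ioo (1 / 3 : ℝ) 1) :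
    ∃ c > 0, batonDensity (c, 0, 0) = x := by
  obtain ⟨h1, h2⟩ := hx
  have h3 : 0 < 1 - x := by linarith
  -- The quadratic is `(c² + c + 1/6) - x (c² + 2c + 1/2)`. It is negative at 0 and equals `2 + (1 -
  -- 3x) / 6 > 0` at `(1 - x)⁻¹`.
  have hcont : ContinuousOn (fun c : ℝ => (1 - x) * c ^ 2 + (1 - 2 * x) * c + (1 - 3 * x) / 6)
      (Set.Icc 0 (1 - x)⁻¹) := by fun_prop
  obtain ⟨c, hc, hc'⟩ := intermediate_value_Icc (inv_nonneg.2 h3.le) hcont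
    (show (0 : ℝ) ∈ _ by
      constructor
      · norm_num; linarith
      · have : (1 - x) * ((1 - x)⁻¹) ^ 2 + (1 - 2 * x) * (1 - x)⁻¹ = 2 := by
          field_simp; ring
        simp only [this]; linarith)
  have hc0 : 0 < c := by
    refine lt_of_le_of_ne hc.1 ?_
    rintro rfl
    norm_num at hc'
    linarith
  refine ⟨c, hc0, ?_⟩
  simp only [batonDensity]
  rw [div_eq_iff (by norm_num; positivity)]
  linarith

section addCaterpillar

variable (k l : ℕ)

lemma size_addCaterpillar (t : GTree) : ((t.addCaterpillar l).size : ℝ) = t.size + 2 * l := by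
  induction l with
  | zero => simp [addCaterpillar]
  | succ l ih => simp only [addCaterpillar, size, Nat.cast_add, ih]; push_cast; ring

/-- There are `(k² + k + 2) / 2` subsets of a `k`-element set with at most two elements. -/
lemma sq_add_le_two_pow : (k : ℝ) ^ 2 + k + 2 ≤ 2 * 2 ^ k := by
  induction k with
  | zero => norm_num
  | succ k ih =>
    have : (k : ℝ) ≤ (k : ℝ) ^ 2 := by exact_mod_cast Nat.le_self_pow two_ne_zero k
    rw [pow_succ (2 : ℝ)]; push_cast; nlinarith

/-- The star with `k` leaves attached to a caterpillar with `2 * l` vertices. -/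
def broom (k l : ℕ) : GTree := (single.addLeaves k).addCaterpillar l

lemma count_broom_le : (broom k l).count ≤ 2 * (broom k l).rootCount := by
  induction l with
  | zero =>
    simp only [broom, addCaterpillar, count_addLeaves, rootCount_addLeaves, count, rootCount]
    nlinarith [sq_add_le_two_pow k]
  | succ l ih =>
    simp only [broom, addCaterpillar, count, rootCount] at ih ⊢
    linarith

/-- The summand `3 * l + k + 1` makes the lower bound reproduce itself exactly under the recursion.
-/
lemma rootSum_broom :
    (3 * l + k) / 2 * (broom k l).rootCount - (broom k l).rootCount + (3 * l + k + 1) ≤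
      (broom k l).rootSum ∧
    (broom k l).rootSum ≤ (3 * l + k) / 2 * (broom k l).rootCount + (broom k l).rootCount := by
  induction l with
  | zero =>
    simp only [broom, addCaterpillar, rootSum_addLeaves, rootCount_addLeaves, rootSum, rootCount]
    constructor <;> norm_num <;> nlinarith [sq_add_le_two_pow k]
  | succ l ih =>
    simp only [broom, addCaterpillar, rootSum, rootCount] at ih ⊢
    push_cast
    constructor <;> linarith

lemma sum_broom :
    (3 * l + k) / 2 * (broom k l).count - 5 * (broom k l).rootCount ≤ (broom k l).sum ∧
    (broom k l).sum ≤ (3 * l + k) / 2 * (broom k l).count + 2 * (broom k l).rootCount := by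
  induction l with
  | zero =>
    simp only [broom, addCaterpillar, rootCount_addLeaves, count_addLeaves, sum_addLeaves,
      count, sum, rootSum, rootCount]
    constructor <;> norm_num <;> nlinarith [sq_add_le_two_pow k]
  | succ l ih =>
    have h1 := rootSum_broom k (l + 1)
    have h2 := count_broom_le k l
    have h3 := (broom k l).one_le_count
    simp only [broom, addCaterpillar, rootSum, rootCount, count, sum] at ih h1 h2 h3 ⊢
    push_cast at h1 ⊢
    constructor <;> linarith

/-- The mean subtree order is `(3l + k) / 2` up to a bounded error, negligible after division by the
size. -/
lemma sum_graft_broom :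
    ((3 * l + k) / 2 - 5) * (graft (broom k l) single).count ≤ (graft (broom k l) single).sum ∧
    (graft (broom k l) single).sum ≤
      ((3 * l + k) / 2 + 5) * (graft (broom k l) single).count := by
  have h1 := rootSum_broom k l
  have h2 := sum_broom k l
  have h3 := (broom k l).one_le_rootCount
  have h4 := (broom k l).rootCount_le_count
  simp only [rootSum, rootCount, count, sum]
  have h5 : (0 : ℝ) ≤ 3 * l + k := by positivity
  constructor <;> linarith

/-- For `l > 0` the root of the broom has degree two; the extra leaf makes it three. -/
lemma reduced_graft_broom (hk : 2 ≤ k) :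
    (graft (broom k l) single).Reduced ∧ (graft (broom k l) single).deg ≠ 2 := by
  have h : (broom k l).Reduced ∧ 2 ≤ (broom k l).deg := by
    induction l with
    | zero =>
      exact ⟨Reduced.addLeaves k trivial, by simpa [broom, addCaterpillar, deg_addLeaves, deg]⟩
    | succ l ih =>
      refine ⟨⟨⟨trivial, trivial, by simp [deg]⟩, ih.1, ?_⟩, by simp [broom, addCaterpillar, deg]⟩
      have := ih.2
      simp only [broom] at this
      omega
  refine ⟨⟨h.1, trivial, by simp [deg]⟩, ?_⟩
  have := h.2
  rw [deg]
  omega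

lemma size_graft_broom : ((graft (broom k l) single).size : ℝ) = 2 * l + k + 2 := by
  simp only [broom, size, Nat.cast_add, size_addCaterpillar, size_addLeaves]
  push_cast; ring

end addCaterpillar

lemma mem_closure_density_isSeriesReduced {x : ℝ} (hx : x ∈ Set.Icc (1 / 2 : ℝ) (3 / 4)) :
    x ∈ closure {d : ℝ | ∃ (n : ℕ) (T : SimpleGraph (Fin n)),
      T.IsTree ∧ IsSeriesReduced T ∧ 2 ≤ n ∧ density T = d} := by
  obtain ⟨hx1, hx2⟩ := hx
  have ha : 0 ≤ 2 * x - 1 := by linarith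
  have hb : 0 ≤ 3 - 4 * x := by linarith
  have hfloor : ∀ {a : ℝ}, 0 ≤ a → Tendsto (fun j : ℕ => (⌊a * j⌋₊ : ℝ) / j) atTop (𝓝 a) :=
    fun h => (tendsto_nat_floor_mul_div_atTop h).comp tendsto_natCast_atTop_atTop
  have hl := hfloor ha
  have hk := hfloor hb
  have hj : Tendsto (fun j : ℕ => 1 / (j : ℝ)) atTop (𝓝 0) := tendsto_one_div_atTop_nhds_zero_nat
  -- These ratios solve `2l + k = j` and `(3l + k) / 2 = x j`; the `+ 2` in `k` secures `2 ≤ k`.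
  let l : ℕ → ℕ := fun j => ⌊(2 * x - 1) * j⌋₊
  let k : ℕ → ℕ := fun j => ⌊(3 - 4 * x) * j⌋₊ + 2
  have hbound : ∀ e : ℝ, Tendsto (fun j : ℕ => ((3 * l j + k j) / 2 + e) / (2 * l j + k j + 2 : ℝ))
      atTop (𝓝 x) := by
    intro e
    have h1 := (((hl.const_mul 3).add hk).add (hj.const_mul (2 + 2 * e))).div_const 2
    have h2 := ((hl.const_mul 2).add hk).add (hj.const_mul 4)
    have h3 := h1.div h2 (by norm_num; linarith)
    have hlim : (3 * (2 * x - 1) + (3 - 4 * x) + (2 + 2 * e) * 0) / 2 /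
        (2 * (2 * x - 1) + (3 - 4 * x) + 4 * 0) = x := by ring_nf
    rw [hlim] at h3
    refine h3.congr' ?_
    filter_upwards [eventually_gt_atTop 0] with j hj
    have hj : (j : ℝ) ≠ 0 := by positivity
    simp only [l, k, Pi.div_apply]
    push_cast
    symm
    rw [← div_div_div_cancel_right₀ hj]
    congr 1
    · field_simp; ring
    · field_simp; ring
  have hpos : ∀ k l, 0 < (graft (broom k l) single).count := fun k l =>
    zero_lt_one.trans_le (one_le_count _)
  have hlim : Tendsto (fun j => (graft (broom (k j) (l j)) single).sum /
      ((graft (broom (k j) (l j)) single).size * (graft (broom (k j) (l j)) single).count))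
      atTop (𝓝 x) := by
    refine tendsto_of_tendsto_of_tendsto_of_le_of_le (hbound (-5)) (hbound 5) ?_ ?_
    · intro j
      beta_reduce
      rw [div_mul_eq_div_div_swap, size_graft_broom]
      gcongr
      rw [le_div_iff₀ (hpos _ _)]
      linarith [(sum_graft_broom (k j) (l j)).1]
    · intro j
      beta_reduce
      rw [div_mul_eq_div_div_swap, size_graft_broom]
      gcongr
      rw [div_le_iff₀ (hpos _ _)]
      exact (sum_graft_broom (k j) (l j)).2
  refine mem_closure_of_tendsto hlim (Eventually.of_forall fun j => ?_)
  have h := reduced_graft_broom (k j) (l j) (Nat.le_add_left 2 _)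
  refine h.1.density_mem h.2 ?_
  have := size_graft_broom (k j) (l j)
  norm_cast at this
  omega

end GTree

theorem Icc_subset_closure_density : Set.Icc (1 / 3 : ℝ) 1 ⊆
    closure {d : ℝ | ∃ (n : ℕ) (T : SimpleGraph (Fin n)), T.IsTree ∧ density T = d} := by
  rw [← closure_Ioo (by norm_num)]
  refine closure_minimal (fun x hx => ?_) isClosed_closure
  obtain ⟨c, hc, rfl⟩ := GTree.exists_batonDensity_eq hx
  exact GTree.batonDensity_mem_closure hc

end SubtreeDensity

theorem mainTheorem4 :
    -- all values for arbitrary finite trees lie in `[1/3, 1]`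
    (∀ {V : Type*} [Finite V] (T : SimpleGraph V), T.IsTree →
      SubtreeDensity.density T ∈ Set.Icc (1 / 3 : ℝ) 1) ∧
    -- these values are dense in `[1/3, 1]`
    Set.Icc (1 / 3 : ℝ) 1 ⊆
      closure {d : ℝ | ∃ (n : ℕ) (T : SimpleGraph (Fin n)),
        T.IsTree ∧ SubtreeDensity.density T = d} ∧
    -- all values for series-reduced trees with more than one vertex lie in `[1/2, 3/4]`
    (∀ {V : Type*} [Finite V] (T : SimpleGraph V), T.IsTree →
      SubtreeDensity.IsSeriesReduced T → 2 ≤ Nat.card V →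
      SubtreeDensity.density T ∈ Set.Icc (1 / 2 : ℝ) (3 / 4)) ∧
    -- these values are dense in `[1/2, 3/4]`
    Set.Icc (1 / 2 : ℝ) (3 / 4) ⊆
      closure {d : ℝ | ∃ (n : ℕ) (T : SimpleGraph (Fin n)),
        T.IsTree ∧ SubtreeDensity.IsSeriesReduced T ∧ 2 ≤ n ∧
        SubtreeDensity.density T = d} := by
  refine ⟨?_, SubtreeDensity.Icc_subset_closure_density, ?_,
    fun x hx => SubtreeDensity.GTree.mem_closure_density_isSeriesReduced hx⟩
  · intro V _ T hT
    cases nonempty_fintype V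
    exact SubtreeDensity.density_mem_Icc hT
  · intro V _ T hT hr hV
    cases nonempty_fintype V
    exact SubtreeDensity.density_mem_Icc_of_isSeriesReduced hT hr hV
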